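/- Let $S$ be a topological semigroup with identity and with a continuous involution $*$ (so $s^{**}=s$ and $(st)^*=t^*s^*$). For a $W^*$-algebra $M$ with predual $M_*$ put $\sigma=\sigma(M,M_*)$. Let $\Omega(S)$ be the class of all pairs $(\omega,M)$, where $M$ is a $W^*$-algebra and $\omega$ is a multiplicative, $*$-preserving, $\sigma$-continuous map of $S$ into the closed unit ball of $M$ such that the linear span of $\omega(S)$ is $\sigma$-dense in $M$. Let $F(S)$ be the set of all functions $\hat\psi=\psi\circ\omega$ on $S$ with $(\omega,M)\in\Omega(S)$ and $\psi\in M_*$. Let $\omega_\Omega$ be the direct sum of the members of $\Omega(S)$ (taken up to isomorphism; multiplicities do not matter), and let $W^*_\Omega(S)$ be the $\sigma$-closed linear span of $\omega_\Omega(S)$. This is a $W^*$-algebra whose predual is identified with $F(S)$ by $\psi\mapsto\hat\psi=\psi\circ\omega_\Omega$; write $\langle x,\hat\psi\rangle=\psi(x)$ for $x\in W^*_\Omega(S)$. Then $W^*_\Omega(S)$ has a topological left invariant mean. That is, there is a bounded linear functional $m$ on $W^*_\Omega(S)$ with $\|m\|=m(1)=1$ such that, for every normal state $\varphi$ of $W^*_\Omega(S)$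 and every $x\in W^*_\Omega(S)$, $$m(x\cdot\varphi)=m(x),$$ where $x\cdot\varphi\in W^*_\Omega(S)$ is the element determined by $\langle x\cdot\varphi,g\rangle=\langle x,\hat\varphi g\rangle$ for all $g\in F(S)$, with $\hat\varphi g$ the pointwise product (in particular, $\hat\varphi g\in F(S)$ and the element $x\cdot\varphi$ exists). -/

import Mathlib

open scoped Topology

universe u v

noncomputable section

namespace TopStarSemigroup

/-! ### Concrete W*-algebras, their preduals and the σ-weak topology -/

section WStar

variable {H : Type v} [NormedAddCommGroup H] [InnerProductSpace ℂ H] [CompleteSpace H]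

/-- The functional `T ↦ ∑ₙ ⟨T ξₙ, ηₙ⟩` on `B(H)`, for square-summable sequences `ξ`, `η` in `H`
(Mathlib's inner product is conjugate-linear in its first argument).
The normal functionals on `B(H)` are exactly those of this form. -/
def normalFunctional (ξ η : lp (fun _ : ℕ => H) 2) (T : H →L[ℂ] H) : ℂ :=
  ∑' n, inner ℂ (η n) (T (ξ n))

variable (H) in
/-- The σ-weak (ultraweak) topology `σ(B(H), B(H)_*)`. It restricts to `σ(M, M_*)` on every
von Neumann algebra `M` acting on `H`. -/
abbrev sigmaWeak : TopologicalSpace (H →L[ℂ] H) :=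
  TopologicalSpace.induced
    (fun T (p : lp (fun _ : ℕ => H) 2 × lp (fun _ : ℕ => H) 2) => normalFunctional p.1 p.2 T)
    Pi.topologicalSpace

/-- The predual `M_*` of a von Neumann algebra `M`: the normal functionals on `M`, i.e. the
restrictions to `M` of the normal functionals on `B(H)`. -/
def predual (M : VonNeumannAlgebra H) : Set (StrongDual ℂ M.toStarSubalgebra) :=
  {ψ | ∃ ξ η : lp (fun _ : ℕ => H) 2,
    ∀ x : M.toStarSubalgebra, ψ x = normalFunctional ξ η (x : H →L[ℂ] H)}

/-- A normal state of `M`: an element of the predual that is positive and takes the value `1`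
at the identity. -/
structure IsNormalState (M : VonNeumannAlgebra H) (φ : StrongDual ℂ M.toStarSubalgebra) :
    Prop where
  normal : φ ∈ predual M
  nonneg : ∀ x : M.toStarSubalgebra, 0 ≤ (φ (star x * x)).re ∧ (φ (star x * x)).im = 0
  map_one : φ 1 = 1

/-! ### The σ-weak closure of a unital *-algebra of operators is its bicommutant -/

/-- The diagonal operator `T ⊕ T ⊕ ⋯` on `ℓ²(ι, H)`. -/
def ampl (ι : Type*) (T : H →L[ℂ] H) :
    lp (fun _ : ι => H) 2 →L[ℂ] lp (fun _ : ι => H) 2 :=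
  lp.mapCLM 2 (fun _ : ι => T) (norm_nonneg T) (fun _ => le_rfl)

theorem ampl_apply {ι : Type*} (T : H →L[ℂ] H) (f : lp (fun _ : ι => H) 2) (i : ι) :
    ampl ι T f i = T (f i) := rfl

theorem normalFunctional_eq (ξ η : lp (fun _ : ℕ => H) 2) (T : H →L[ℂ] H) :
    normalFunctional ξ η T = inner ℂ η (ampl ℕ T ξ) := by
  rw [lp.inner_eq_tsum]; rfl

theorem continuous_normalFunctional (ξ η : lp (fun _ : ℕ => H) 2) :
    Continuous[sigmaWeak H, inferInstance] (normalFunctional ξ η) :=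
  @Continuous.comp _ _ _ (sigmaWeak H) Pi.topologicalSpace _
    (fun T (p : lp (fun _ : ℕ => H) 2 × lp (fun _ : ℕ => H) 2) => normalFunctional p.1 p.2 T)
    (fun F => F (ξ, η)) (continuous_apply (ξ, η)) continuous_induced_dom

theorem normalFunctional_single (a b : H) (R : H →L[ℂ] H) :
    normalFunctional (lp.single 2 0 a) (lp.single 2 0 b) R = inner ℂ b (R a) := by
  rw [normalFunctional_eq, lp.inner_single_left, ampl_apply, lp.single_apply_self]

/-- Matrix coefficients that agree on a set agree on its σ-weak closure. -/
theorem inner_eq_of_mem_closure {W : Set (H →L[ℂ] H)} {x y x' y' : H}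
    (h : ∀ R ∈ W, inner ℂ y (R x) = inner ℂ y' (R x')) {T : H →L[ℂ] H}
    (hT : T ∈ closure[sigmaWeak H] W) : inner ℂ y (T x) = inner ℂ y' (T x') := by
  have := @Set.EqOn.closure _ _ _ (sigmaWeak H) _ W
    (normalFunctional (lp.single 2 0 x) (lp.single 2 0 y))
    (normalFunctional (lp.single 2 0 x') (lp.single 2 0 y'))
    (fun R hR => by rw [normalFunctional_single, normalFunctional_single]; exact h R hR)
    (continuous_normalFunctional _ _) (continuous_normalFunctional _ _)
  simpa only [normalFunctional_single] using this hT

/-- `T ↦ (T ⊕ T ⊕ ⋯) ξ` as a linear map. -/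
def amplAt {ι : Type*} (ξ : lp (fun _ : ι => H) 2) :
    (H →L[ℂ] H) →ₗ[ℂ] lp (fun _ : ι => H) 2 where
  toFun T := ampl ι T ξ
  map_add' S T := by ext i; simp [ampl_apply]
  map_smul' c T := by ext i; simp [ampl_apply]

theorem ampl_mem_closure {ι : Type*} (W : Submodule ℂ (H →L[ℂ] H)) (h1 : 1 ∈ W)
    (hmul : ∀ a ∈ W, ∀ b ∈ W, a * b ∈ W) (hstar : ∀ a ∈ W, star a ∈ W)
    {T : H →L[ℂ] H} (hT : T ∈ Set.centralizer (Set.centralizer (W : Set (H →L[ℂ] H))))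
    (ξ : lp (fun _ : ι => H) 2) :
    ampl ι T ξ ∈ (W.map (amplAt ξ)).topologicalClosure := by
  classical
  set K := (W.map (amplAt ξ)).topologicalClosure with hK
  have hKinv : ∀ b ∈ W, ∀ x ∈ K, ampl ι b x ∈ K := by
    intro b hb x hx
    have hmaps : Set.MapsTo (ampl ι b) (W.map (amplAt ξ) : Set (lp (fun _ : ι => H) 2))
        (W.map (amplAt ξ) : Set (lp (fun _ : ι => H) 2)) := by
      rintro _ ⟨a, ha, rfl⟩
      exact ⟨b * a, hmul b hb a ha, by ext i; rfl⟩
    exact hmaps.closure (ampl ι b).continuous hx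
  have hadj : ∀ b : H →L[ℂ] H, ∀ x y : lp (fun _ : ι => H) 2,
      inner ℂ (ampl ι (star b) x) y = inner ℂ x (ampl ι b y) := by
    intro b x y
    rw [lp.inner_eq_tsum, lp.inner_eq_tsum]
    refine tsum_congr fun i => ?_
    rw [ampl_apply, ampl_apply, ContinuousLinearMap.star_eq_adjoint,
      ContinuousLinearMap.adjoint_inner_left]
  have hKoinv : ∀ b ∈ W, ∀ x ∈ Kᗮ, ampl ι b x ∈ Kᗮ := by
    intro b hb x hx
    rw [Submodule.mem_orthogonal] at hx ⊢
    intro y hy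
    rw [← hadj]
    exact hx _ (hKinv _ (hstar b hb) y hy)
  have : CompleteSpace K := (Submodule.isClosed_topologicalClosure _).completeSpace_coe
  set P := K.starProjection with hP
  have hcomm : ∀ b ∈ W, ∀ x, P (ampl ι b x) = ampl ι b (P x) := by
    intro b hb x
    refine (Submodule.eq_starProjection_of_mem_orthogonal' (u := ampl ι b x)
      (v := ampl ι b (P x)) (z := ampl ι b (x - P x)) ?_ ?_ ?_)
    · exact hKinv b hb _ (Submodule.starProjection_apply_mem _ _)
    · exact hKoinv b hb _ (Submodule.sub_starProjection_mem_orthogonal _)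
    · rw [← map_add]; simp
  have hcommT : P ∘L ampl ι T = ampl ι T ∘L P := by
    refine lp.ext_continuousLinearMap ENNReal.ofNat_ne_top fun j => ?_
    ext x i
    have hc : (lp.evalCLM ℂ (fun _ : ι => H) 2 i ∘L P ∘L
        lp.singleContinuousLinearMap ℂ (fun _ : ι => H) 2 j) ∈
        Set.centralizer (W : Set (H →L[ℂ] H)) := by
      intro b hb
      ext y
      have := congrArg (fun f : lp (fun _ : ι => H) 2 => f i) (hcomm b hb (lp.single 2 j y))
      have h2 : ampl ι b (lp.single 2 j y) = lp.single 2 j (b y) := by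
        ext k
        rw [ampl_apply, lp.single_apply, lp.single_apply]
        exact (Pi.apply_single (fun _ : ι => (b : H → H)) (fun _ => map_zero b) j y k)
      rw [h2] at this
      exact this.symm
    have h3 := congrArg (fun f : H →L[ℂ] H => f x) (hT _ hc)
    have h2 : ampl ι T (lp.single 2 j x) = lp.single 2 j (T x) := by
      ext k
      rw [ampl_apply, lp.single_apply, lp.single_apply]
      exact (Pi.apply_single (fun _ : ι => (T : H → H)) (fun _ => map_zero T) j x k)
    change P (ampl ι T (lp.single 2 j x)) i = T (P (lp.single 2 j x) i)
    rw [h2]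
    exact h3
  have hξ : ξ ∈ K := by
    refine Submodule.le_topologicalClosure _ ⟨1, h1, ?_⟩
    ext i; rfl
  have hPξ : P ξ = ξ := Submodule.starProjection_eq_self_iff.2 hξ
  have := congrArg (fun f => f ξ) hcommT
  simp only [ContinuousLinearMap.comp_apply, hPξ] at this
  rw [← this]
  exact Submodule.starProjection_apply_mem _ _

/-- The combination of finitely many elements of `ℓ²(ℕ, H)` into one element. -/
def combine (F : Finset (lp (fun _ : ℕ => H) 2 × lp (fun _ : ℕ => H) 2)) :
    lp (fun _ : F × ℕ => H) 2 :=
  ⟨fun q => q.1.1.1 q.2, by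
    refine memℓp_gen ?_
    rw [summable_prod_of_nonneg (fun q => by positivity)]
    exact ⟨fun p => (lp.memℓp p.1.1).summable (by norm_num), Summable.of_finite⟩⟩

theorem norm_ampl_le_combine (F : Finset (lp (fun _ : ℕ => H) 2 × lp (fun _ : ℕ => H) 2))
    (p : F) (T : H →L[ℂ] H) : ‖ampl ℕ T p.1.1‖ ≤ ‖ampl (F × ℕ) T (combine F)‖ := by
  refine lp.norm_le_of_forall_sum_le (by norm_num) (norm_nonneg _) fun s => ?_
  have := lp.sum_rpow_le_norm_rpow (p := 2) (by norm_num) (ampl (F × ℕ) T (combine F))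
    (s.map ⟨fun n => (p, n), fun a b h => (Prod.ext_iff.1 h).2⟩)
  rw [Finset.sum_map] at this
  exact this

/-- The double commutant theorem: the bicommutant of a unital *-algebra of operators is its
σ-weak closure. -/
theorem closure_eq_bicommutant (W : Submodule ℂ (H →L[ℂ] H)) (h1 : 1 ∈ W)
    (hmul : ∀ a ∈ W, ∀ b ∈ W, a * b ∈ W) (hstar : ∀ a ∈ W, star a ∈ W) :
    closure[sigmaWeak H] (W : Set (H →L[ℂ] H)) =
      Set.centralizer (Set.centralizer (W : Set (H →L[ℂ] H))) := by
  classical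
  refine Set.Subset.antisymm ?_ ?_
  · intro T hT c hc
    ext x
    refine ext_inner_left ℂ fun y => ?_
    have := inner_eq_of_mem_closure (x := c x) (y := y) (x' := x) (y' := star c y)
      (fun R hR => ?_) hT
    · rw [ContinuousLinearMap.star_eq_adjoint, ContinuousLinearMap.adjoint_inner_left] at this
      exact this.symm
    · rw [ContinuousLinearMap.star_eq_adjoint, ContinuousLinearMap.adjoint_inner_left]
      exact congrArg (fun f : H →L[ℂ] H => inner ℂ y (f x)) (hc R hR)
  · intro T hT
    unfold sigmaWeak
    rw [closure_induced, mem_closure_iff_nhds]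
    intro U hU
    rw [nhds_pi, Filter.mem_pi'] at hU
    obtain ⟨F, t, ht, hsub⟩ := hU
    have hε : ∃ ε > 0, ∀ p ∈ F, Metric.ball (normalFunctional p.1 p.2 T) ε ⊆ t p := by
      choose e he hb using fun p => Metric.mem_nhds_iff.1 (ht p)
      rcases F.eq_empty_or_nonempty with rfl | hF
      · exact ⟨1, one_pos, by simp⟩
      · refine ⟨F.inf' hF e, (Finset.lt_inf'_iff hF).2 fun p _ => he p, fun p hp => ?_⟩
        exact (Metric.ball_subset_ball (Finset.inf'_le e hp)).trans (hb p)
    obtain ⟨ε, hε, hball⟩ := hε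
    set C : ℝ := 1 + ∑ p ∈ F, ‖p.2‖ with hC
    have hCpos : 0 < C := by positivity
    have hmem := ampl_mem_closure W h1 hmul hstar hT (combine F)
    obtain ⟨_, ⟨a, ha, rfl⟩, hdist⟩ := Metric.mem_closure_iff.1 hmem (ε / C) (by positivity)
    refine ⟨_, hsub ?_, ⟨a, ha, rfl⟩⟩
    intro p hp
    refine hball p hp ?_
    change dist (normalFunctional p.1 p.2 a) (normalFunctional p.1 p.2 T) < ε
    rw [dist_comm, dist_eq_norm, normalFunctional_eq, normalFunctional_eq, ← inner_sub_right]
    have hlin : ampl ℕ T p.1 - ampl ℕ a p.1 = ampl ℕ (T - a) p.1 :=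
      (map_sub (amplAt p.1) T a).symm
    have hlin' : ampl (F × ℕ) T (combine F) - amplAt (combine F) a =
        ampl (F × ℕ) (T - a) (combine F) := (map_sub (amplAt (combine F)) T a).symm
    rw [dist_eq_norm, hlin'] at hdist
    rw [hlin]
    calc _ ≤ ‖p.2‖ * ‖ampl ℕ (T - a) p.1‖ := norm_inner_le_norm _ _
      _ ≤ C * ‖ampl (F × ℕ) (T - a) (combine F)‖ := by
          refine mul_le_mul ?_ (norm_ampl_le_combine F ⟨p, hp⟩ _) (norm_nonneg _) hCpos.le
          have := Finset.single_le_sum (f := fun p : lp (fun _ : ℕ => H) 2 ×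
            lp (fun _ : ℕ => H) 2 => ‖p.2‖) (fun i _ => norm_nonneg _) hp
          simp only [hC] at this ⊢
          linarith
      _ < C * (ε / C) := by gcongr
      _ = ε := by field_simp

end WStar

/-! ### *-representations and the universal representation -/

/-- A σ-continuous *-representation `(ω, M)` of a topological semigroup with involution `S`:
a map `ω` of `S` into the unit ball of a W*-algebra `M` that is multiplicative, *-preserving and
continuous for `σ(M, M_*)`, and such that the linear span of `ω(S)` is `σ(M, M_*)`-dense in `M`.
W*-algebras are realized as von Neumann algebras on Hilbert spaces. -/
structure StarRep (S : Type u) [Mul S] [Star S] [TopologicalSpace S] where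
  /-- the Hilbert space -/
  H : Type v
  [normedAddCommGroup : NormedAddCommGroup H]
  [innerProductSpace : InnerProductSpace ℂ H]
  [completeSpace : CompleteSpace H]
  /-- the W*-algebra -/
  M : VonNeumannAlgebra H
  /-- the homomorphism -/
  ω : S → (H →L[ℂ] H)
  mem : ∀ s, ω s ∈ M
  norm_le_one : ∀ s, ‖ω s‖ ≤ 1
  map_mul : ∀ s t, ω (s * t) = ω s * ω t
  map_star : ∀ s, ω (star s) = star (ω s)
  continuous : Continuous[inferInstance, sigmaWeak H] ω
  dense : closure[sigmaWeak H] (Submodule.span ℂ (Set.range ω) : Set (H →L[ℂ] H)) = M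

attribute [instance] StarRep.normedAddCommGroup StarRep.innerProductSpace StarRep.completeSpace

/-- The class `Ω(S)` of σ-continuous *-representations of `S`. Since `M` is generated by the image
of `S`, Hilbert spaces in the universe of `S` suffice: every `(ω, M)` is isomorphic to one on such
a Hilbert space. -/
abbrev Omega (S : Type u) [Mul S] [Star S] [TopologicalSpace S] : Type (u + 1) :=
  StarRep.{u, u} S

/-- The function `ψ̂ = ψ ∘ ω` on `S`. -/
def StarRep.hat {S : Type u} [Mul S] [Star S] [TopologicalSpace S] (π : StarRep.{u, v} S)
    (ψ : StrongDual ℂ π.M.toStarSubalgebra) (s : S) : ℂ :=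
  ψ ⟨π.ω s, π.mem s⟩

/-- The Fourier–Stieltjes algebra `F(S)`: all functions `ψ̂` with `ψ ∈ M_*`, `(ω, M) ∈ Ω(S)`. -/
def fourierStieltjes (S : Type u) [Mul S] [Star S] [TopologicalSpace S] : Set (S → ℂ) :=
  {f | ∃ π : Omega S, ∃ ψ ∈ predual π.M, π.hat ψ = f}

section Universal

variable (S : Type u) [Monoid S] [StarMul S] [TopologicalSpace S]

/-- The Hilbert space `H_Ω`: the Hilbert sum of the spaces of all members of `Ω(S)`. -/
abbrev UniversalSpace : Type (u + 1) := lp (fun π : Omega S => π.H) 2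

variable {S}

/-- The direct sum `ω_Ω(s) = ⊕ ω(s)` over all `(ω, M) ∈ Ω(S)`. -/
def universalHom (s : S) : UniversalSpace S →L[ℂ] UniversalSpace S :=
  lp.mapCLM 2 (fun π : Omega S => π.ω s) zero_le_one (fun π => π.norm_le_one s)

theorem universalHom_apply (s : S) (f : UniversalSpace S) (π : Omega S) :
    universalHom s f π = π.ω s (f π) := rfl

theorem universalHom_norm_le (s : S) : ‖universalHom s‖ ≤ 1 :=
  lp.norm_mapCLM_le 2 _ zero_le_one _

theorem universalHom_mul (s t : S) :
    universalHom (s * t) = universalHom s * universalHom t := by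
  ext f π
  change π.ω (s * t) (f π) = π.ω s (π.ω t (f π))
  rw [π.map_mul]; rfl

theorem universalHom_star (s : S) : universalHom (star s) = star (universalHom s) := by
  rw [ContinuousLinearMap.star_eq_adjoint, ContinuousLinearMap.eq_adjoint_iff]
  intro f g
  rw [lp.inner_eq_tsum, lp.inner_eq_tsum]
  refine tsum_congr fun π => ?_
  rw [universalHom_apply, universalHom_apply, π.map_star, ContinuousLinearMap.star_eq_adjoint,
    ContinuousLinearMap.adjoint_inner_left]

theorem StarRep.map_one (π : StarRep.{u, v} S) : π.ω 1 = 1 := by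
  have hone : (1 : π.H →L[ℂ] π.H) ∈ π.M := one_mem _
  rw [← SetLike.mem_coe, ← π.dense] at hone
  ext x
  refine ext_inner_left ℂ fun y => ?_
  have := inner_eq_of_mem_closure (x := x) (y := star (π.ω 1) y) (x' := x) (y' := y)
    (fun R hR => ?_) hone
  · rwa [ContinuousLinearMap.star_eq_adjoint, ContinuousLinearMap.adjoint_inner_left] at this
  · have h : π.ω 1 * R = R := by
      refine Submodule.span_induction (p := fun R _ => π.ω 1 * R = R) ?_ (by simp) ?_ ?_ hR
      · rintro _ ⟨s, rfl⟩; rw [← π.map_mul, one_mul]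
      · intro a b _ _ ha hb; rw [mul_add, ha, hb]
      · intro c a _ ha; rw [mul_smul_comm, ha]
    rw [ContinuousLinearMap.star_eq_adjoint, ContinuousLinearMap.adjoint_inner_left]
    exact congrArg (fun f : π.H →L[ℂ] π.H => inner ℂ y (f x)) h

theorem universalHom_one : universalHom (1 : S) = 1 := by
  ext f π
  change π.ω 1 (f π) = f π
  rw [π.map_one]; rfl

theorem StarRep.continuous_inner (π : StarRep.{u, v} S) (x y : π.H) :
    Continuous fun s => inner ℂ y (π.ω s x) := by
  have := @Continuous.comp _ _ _ _ (sigmaWeak π.H) _ _ _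
    (continuous_normalFunctional (lp.single 2 0 x) (lp.single 2 0 y)) π.continuous
  exact this.congr fun s => normalFunctional_single _ _ _

theorem summable_norm_mul_norm {ι : Type*} {E : ι → Type*} [∀ i, NormedAddCommGroup (E i)]
    (f g : lp E 2) : Summable fun i => ‖f i‖ * ‖g i‖ := by
  refine lp.summable_mul ?_ f g
  rw [Real.holderConjugate_iff]; norm_num

theorem universalHom_continuous :
    Continuous[inferInstance, sigmaWeak (UniversalSpace S)] (universalHom (S := S)) := by
  have hcw : ∀ x y : UniversalSpace S, Continuous fun s => inner ℂ y (universalHom s x) := by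
    intro x y
    simp only [lp.inner_eq_tsum]
    refine continuous_tsum (fun π => π.continuous_inner (x π) (y π))
      (summable_norm_mul_norm y x) fun π s => ?_
    refine (norm_inner_le_norm _ _).trans ?_
    gcongr
    exact (π.ω s).le_of_opNorm_le (π.norm_le_one s) _ |>.trans_eq (one_mul _)
  refine continuous_induced_rng.2 (continuous_pi fun p => ?_)
  refine continuous_tsum (fun n => hcw (p.1 n) (p.2 n))
    (summable_norm_mul_norm p.2 p.1) fun n s => ?_
  refine (norm_inner_le_norm _ _).trans ?_
  gcongr
  exact (universalHom s).le_of_opNorm_le (universalHom_norm_le s) _ |>.trans_eq (one_mul _)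

variable (S)

theorem universal_closure :
    closure[sigmaWeak (UniversalSpace S)] (Submodule.span ℂ (Set.range (universalHom (S := S))) :
      Set (UniversalSpace S →L[ℂ] UniversalSpace S)) =
      Set.centralizer (Set.centralizer (Set.range (universalHom (S := S)))) := by
  rw [closure_eq_bicommutant]
  · congr 1
    ext c
    refine ⟨fun h a ha => h a (Submodule.subset_span ha), fun h a ha => ?_⟩
    refine Submodule.span_induction (p := fun a _ => a * c = c * a) (fun a ha => h a ha)
      (by simp) ?_ ?_ ha
    · intro a b _ _ h₁ h₂; rw [add_mul, mul_add, h₁, h₂]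
    · intro r a _ h₁; rw [smul_mul_assoc, mul_smul_comm, h₁]
  · exact Submodule.subset_span ⟨1, universalHom_one⟩
  · intro a ha b hb
    refine Submodule.span_induction₂ (p := fun a b _ _ => a * b ∈ _) ?_ ?_ ?_ ?_ ?_ ?_ ?_ ha hb
    · rintro _ _ ⟨s, rfl⟩ ⟨t, rfl⟩
      exact Submodule.subset_span ⟨s * t, universalHom_mul s t⟩
    · intro y _; simp
    · intro y _; simp
    · intro x y z _ _ _ h₁ h₂; rw [add_mul]; exact Submodule.add_mem _ h₁ h₂
    · intro x y z _ _ _ h₁ h₂; rw [mul_add]; exact Submodule.add_mem _ h₁ h₂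
    · intro r x y _ _ h; rw [smul_mul_assoc]; exact Submodule.smul_mem _ _ h
    · intro r x y _ _ h; rw [mul_smul_comm]; exact Submodule.smul_mem _ _ h
  · intro a ha
    refine Submodule.span_induction (p := fun a _ => star a ∈ _) ?_ (by simp) ?_ ?_ ha
    · rintro _ ⟨s, rfl⟩
      exact Submodule.subset_span ⟨star s, universalHom_star s⟩
    · intro a b _ _ h₁ h₂; rw [star_add]; exact Submodule.add_mem _ h₁ h₂
    · intro r a _ h₁; rw [star_smul]; exact Submodule.smul_mem _ _ h₁

theorem universal_star_range :
    star (Set.range (universalHom (S := S))) ⊆ Set.range (universalHom (S := S)) := by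
  rintro a ⟨s, hs⟩
  exact ⟨star s, by rw [universalHom_star, hs, star_star]⟩

/-- The W*-algebra `M_Ω` generated by `ω_Ω(S)` in `B(H_Ω)`. It is the σ-weak closure of the linear
span of `ω_Ω(S)`, see `universal_closure`. -/
def universalAlgebra : VonNeumannAlgebra (UniversalSpace S) where
  toStarSubalgebra := StarSubalgebra.centralizer ℂ
    (SetLike.coe (StarSubalgebra.centralizer ℂ (Set.range (universalHom (S := S)))))
  centralizer_centralizer' := by
    change Set.centralizer (Set.centralizer (SetLike.coe (StarSubalgebra.centralizer ℂ
      (SetLike.coe (StarSubalgebra.centralizer ℂ (Set.range (universalHom (S := S)))))))) =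
      SetLike.coe (StarSubalgebra.centralizer ℂ
      (SetLike.coe (StarSubalgebra.centralizer ℂ (Set.range (universalHom (S := S))))))
    rw [StarSubalgebra.coe_centralizer_centralizer, Set.centralizer_centralizer_centralizer]

theorem coe_universalAlgebra : (universalAlgebra S : Set (UniversalSpace S →L[ℂ] UniversalSpace S)) =
    Set.centralizer (Set.centralizer (Set.range (universalHom (S := S)))) := by
  change SetLike.coe (StarSubalgebra.centralizer ℂ
      (SetLike.coe (StarSubalgebra.centralizer ℂ (Set.range (universalHom (S := S)))))) = _
  rw [StarSubalgebra.coe_centralizer_centralizer, Set.union_eq_left.2 (universal_star_range S)]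

/-- The universal representation `(ω_Ω, M_Ω)` of `S`. -/
def universalRep : StarRep.{u, u + 1} S where
  H := UniversalSpace S
  M := universalAlgebra S
  ω := universalHom
  mem s := by
    rw [← SetLike.mem_coe, coe_universalAlgebra]
    exact Set.subset_centralizer_centralizer ⟨s, rfl⟩
  norm_le_one := universalHom_norm_le
  map_mul := universalHom_mul
  map_star := universalHom_star
  continuous := universalHom_continuous
  dense := (universal_closure S).trans (coe_universalAlgebra S).symm

/-- The W*-algebra `W*_Ω(S)` of the universal representation. -/
abbrev WStarOmega : Type (u + 1) := (universalRep S).M.toStarSubalgebra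

variable {S}

/-! ### Duality with `F(S)` and topological left invariant means -/

/-- `⟨x, f⟩ = c` in the duality between `W*_Ω(S)` and `F(S)`: this means that `f = ψ̂` for a normal
functional `ψ` on `W*_Ω(S)` with `ψ(x) = c`. -/
def Pairing (x : WStarOmega S) (f : S → ℂ) (c : ℂ) : Prop :=
  ∃ ψ ∈ predual (universalRep S).M, (universalRep S).hat ψ = f ∧ ψ x = c

/-- `y = x · f`, the (dual) module action of `f ∈ F(S)` on `x ∈ W*_Ω(S)`:
`⟨x · f, g⟩ = ⟨x, f g⟩` for all `g ∈ F(S)`, with the pointwise product `f g`. The two pairings are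
required to be defined, so in particular `f g ∈ F(S)`. -/
def IsAction (x : WStarOmega S) (f : S → ℂ) (y : WStarOmega S) : Prop :=
  ∀ g ∈ fourierStieltjes S, ∃ c : ℂ, Pairing y g c ∧ Pairing x (f * g) c

/-- A topological left invariant mean on `W*_Ω(S)`: a bounded functional `m` with
`‖m‖ = m(1) = 1` such that `m(x · φ) = m(x)` for every `x` and every normal state `φ`
(viewed as the element `φ̂` of `F(S)`). The element `x · φ` is required to exist. -/
structure IsTopologicalLeftInvariantMean (m : StrongDual ℂ (WStarOmega S)) : Prop where
  norm_eq_one : ‖m‖ = 1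
  map_one : m 1 = 1
  invariant : ∀ φ : StrongDual ℂ (WStarOmega S), IsNormalState (universalRep S).M φ →
    ∀ x : WStarOmega S, ∃ y : WStarOmega S,
      IsAction x ((universalRep S).hat φ) y ∧ m y = m x

end Universal

end TopStarSemigroup

end

noncomputable section

namespace TopStarSemigroup

/-! ### Small Hilbert spaces -/

theorem small_closure_of_small {E : Type*} [PseudoMetricSpace E] [T2Space E] (s : Set E)
    [Small.{u} s] : Small.{u} (closure s) := by
  rcases isEmpty_or_nonempty E with hE | hE
  · exact small_of_surjective (f := fun x : s => (⟨x, subset_closure x.2⟩ : closure s))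
      fun x => isEmptyElim (x : E)
  · let l : (ℕ → s) → E := fun f => Filter.atTop.limUnder fun n => (f n : E)
    refine small_subset (s := Set.range l) fun x hx => ?_
    obtain ⟨f, hf, hlim⟩ := mem_closure_iff_seq_limit.1 hx
    exact ⟨fun n => ⟨f n, hf n⟩, hlim.limUnder_eq⟩

/-- A Hilbert space whose underlying type is small is isometric to an `ℓ²` space in the smaller
universe. -/
theorem exists_linearIsometryEquiv_lp (E : Type v) [NormedAddCommGroup E] [InnerProductSpace ℂ E]
    [CompleteSpace E] [Small.{u} E] :
    ∃ ι : Type u, Nonempty (E ≃ₗᵢ[ℂ] lp (fun _ : ι => ℂ) 2) := by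
  obtain ⟨w, b, -⟩ := exists_hilbertBasis ℂ E
  let e : w ≃ Shrink.{u} w := equivShrink w
  refine ⟨Shrink.{u} w, ⟨(HilbertBasis.mk (v := b ∘ e.symm)
    (b.orthonormal.comp _ e.symm.injective) ?_).repr⟩⟩
  rw [e.symm.surjective.range_comp]
  exact b.dense_span.ge

/-! ### Weakly continuous contractive *-representations -/

section Rep

variable {S : Type u} [Monoid S] [StarMul S]

/-- A unital *-representation of `S` by contractions on a Hilbert space. -/
structure IsContractiveRep {K : Type v} [NormedAddCommGroup K] [InnerProductSpace ℂ K]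
    [CompleteSpace K] (ρ : S → K →L[ℂ] K) : Prop where
  map_one : ρ 1 = 1
  map_mul : ∀ s t, ρ (s * t) = ρ s * ρ t
  map_star : ∀ s, ρ (star s) = star (ρ s)
  norm_le_one : ∀ s, ‖ρ s‖ ≤ 1

namespace IsContractiveRep

variable {K : Type v} [NormedAddCommGroup K] [InnerProductSpace ℂ K] [CompleteSpace K]
  {ρ : S → K →L[ℂ] K}

theorem norm_apply_le (h : IsContractiveRep ρ) (s : S) (x : K) : ‖ρ s x‖ ≤ ‖x‖ := by
  simpa using (ρ s).le_of_opNorm_le (h.norm_le_one s) x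

theorem inner_star_apply (h : IsContractiveRep ρ) (s : S) (x y : K) :
    inner ℂ (ρ (star s) x) y = inner ℂ x (ρ s y) := by
  rw [h.map_star, ContinuousLinearMap.star_eq_adjoint, ContinuousLinearMap.adjoint_inner_left]

theorem span_mul_mem (h : IsContractiveRep ρ) {a b : K →L[ℂ] K}
    (ha : a ∈ Submodule.span ℂ (Set.range ρ)) (hb : b ∈ Submodule.span ℂ (Set.range ρ)) :
    a * b ∈ Submodule.span ℂ (Set.range ρ) := by
  refine Submodule.span_induction₂ (p := fun a b _ _ => a * b ∈ _) ?_ ?_ ?_ ?_ ?_ ?_ ?_ ha hb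
  · rintro _ _ ⟨s, rfl⟩ ⟨t, rfl⟩
    exact Submodule.subset_span ⟨s * t, h.map_mul s t⟩
  · intro y _; simp
  · intro y _; simp
  · intro x y z _ _ _ h₁ h₂; rw [add_mul]; exact Submodule.add_mem _ h₁ h₂
  · intro x y z _ _ _ h₁ h₂; rw [mul_add]; exact Submodule.add_mem _ h₁ h₂
  · intro r x y _ _ h; rw [smul_mul_assoc]; exact Submodule.smul_mem _ _ h
  · intro r x y _ _ h; rw [mul_smul_comm]; exact Submodule.smul_mem _ _ h

theorem span_star_mem (h : IsContractiveRep ρ) {a : K →L[ℂ] K}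
    (ha : a ∈ Submodule.span ℂ (Set.range ρ)) : star a ∈ Submodule.span ℂ (Set.range ρ) := by
  refine Submodule.span_induction (p := fun a _ => star a ∈ _) ?_ (by simp) ?_ ?_ ha
  · rintro _ ⟨s, rfl⟩
    exact Submodule.subset_span ⟨star s, h.map_star s⟩
  · intro a b _ _ h₁ h₂; rw [star_add]; exact Submodule.add_mem _ h₁ h₂
  · intro r a _ h₁; rw [star_smul]; exact Submodule.smul_mem _ _ h₁

variable (ρ) in
/-- The von Neumann algebra generated by the image of a representation. -/
def generated (h : IsContractiveRep ρ) : VonNeumannAlgebra K where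
  toStarSubalgebra := StarSubalgebra.centralizer ℂ
    (SetLike.coe (StarSubalgebra.centralizer ℂ (Submodule.span ℂ (Set.range ρ) : Set (K →L[ℂ] K))))
  centralizer_centralizer' := by
    have hs : star (Submodule.span ℂ (Set.range ρ) : Set (K →L[ℂ] K)) ⊆
        (Submodule.span ℂ (Set.range ρ) : Set (K →L[ℂ] K)) := fun a ha =>
      by simpa using h.span_star_mem (a := star a) ha
    change Set.centralizer (Set.centralizer (SetLike.coe (StarSubalgebra.centralizer ℂ
      (SetLike.coe (StarSubalgebra.centralizer ℂ
        (Submodule.span ℂ (Set.range ρ) : Set (K →L[ℂ] K))))))) =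
      SetLike.coe (StarSubalgebra.centralizer ℂ (SetLike.coe (StarSubalgebra.centralizer ℂ
        (Submodule.span ℂ (Set.range ρ) : Set (K →L[ℂ] K)))))
    rw [StarSubalgebra.coe_centralizer_centralizer, Set.union_eq_left.2 hs,
      Set.centralizer_centralizer_centralizer]

theorem coe_generated (h : IsContractiveRep ρ) : (generated ρ h : Set (K →L[ℂ] K)) =
    Set.centralizer (Set.centralizer (Submodule.span ℂ (Set.range ρ) : Set (K →L[ℂ] K))) := by
  have hs : star (Submodule.span ℂ (Set.range ρ) : Set (K →L[ℂ] K)) ⊆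
      (Submodule.span ℂ (Set.range ρ) : Set (K →L[ℂ] K)) := fun a ha =>
    by simpa using h.span_star_mem (a := star a) ha
  change SetLike.coe (StarSubalgebra.centralizer ℂ (SetLike.coe (StarSubalgebra.centralizer ℂ
        (Submodule.span ℂ (Set.range ρ) : Set (K →L[ℂ] K))))) = _
  rw [StarSubalgebra.coe_centralizer_centralizer, Set.union_eq_left.2 hs]

/-- Compression of a representation along an isometry with invariant range. -/
theorem compress (h : IsContractiveRep ρ) {L : Type*} [NormedAddCommGroup L]
    [InnerProductSpace ℂ L] [CompleteSpace L] (J : L →ₗᵢ[ℂ] K)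
    (hJ : ∀ s x, ∃ y, ρ s (J x) = J y) :
    ∃ π : S → L →L[ℂ] L, IsContractiveRep π ∧ ∀ s x, J (π s x) = ρ s (J x) := by
  choose f hf using hJ
  let π : S → L →L[ℂ] L := fun s => LinearMap.mkContinuous
    { toFun := f s
      map_add' := fun x y => J.injective (by rw [map_add, ← hf, ← hf, ← hf, map_add, map_add])
      map_smul' := fun c x => J.injective (by
        rw [RingHom.id_apply, map_smul, ← hf, ← hf, map_smul, map_smul]) } 1 (fun x => by
      change ‖f s x‖ ≤ _
      rw [← J.norm_map, ← hf, one_mul]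
      exact (h.norm_apply_le s _).trans_eq (J.norm_map x))
  have hπ : ∀ s x, J (π s x) = ρ s (J x) := fun s x => (hf s x).symm
  refine ⟨π, ⟨?_, fun s t => ?_, fun s => ?_, fun s => ?_⟩, hπ⟩
  · ext x
    exact J.injective (by rw [hπ, h.map_one]; rfl)
  · ext x
    refine J.injective ?_
    rw [hπ, h.map_mul, mul_apply_eq_comp, mul_apply_eq_comp, hπ, hπ]
  · rw [ContinuousLinearMap.star_eq_adjoint, ContinuousLinearMap.eq_adjoint_iff]
    intro x y
    rw [← J.inner_map_map, hπ, h.inner_star_apply, ← hπ, J.inner_map_map]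
  · exact LinearMap.mkContinuous_norm_le _ zero_le_one _

variable [TopologicalSpace S]

theorem continuous_sigmaWeak (h : IsContractiveRep ρ)
    (hc : ∀ x y, Continuous fun s => inner ℂ y (ρ s x)) :
    Continuous[inferInstance, sigmaWeak K] ρ := by
  refine continuous_induced_rng.2 (continuous_pi fun p => ?_)
  refine continuous_tsum (fun n => hc (p.1 n) (p.2 n))
    (summable_norm_mul_norm p.2 p.1) fun n s => ?_
  refine (norm_inner_le_norm _ _).trans ?_
  gcongr
  exact h.norm_apply_le s _

/-- A weakly continuous representation by contractions, as an object of `StarRep`. -/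
def toStarRep (h : IsContractiveRep ρ) (hc : ∀ x y, Continuous fun s => inner ℂ y (ρ s x)) :
    StarRep.{u, v} S where
  H := K
  M := generated ρ h
  ω := ρ
  mem s := by
    rw [← SetLike.mem_coe, coe_generated]
    exact Set.subset_centralizer_centralizer (Submodule.subset_span ⟨s, rfl⟩)
  norm_le_one := h.norm_le_one
  map_mul := h.map_mul
  map_star := h.map_star
  continuous := h.continuous_sigmaWeak hc
  dense := by
    rw [coe_generated, closure_eq_bicommutant]
    · exact Submodule.subset_span ⟨1, h.map_one⟩
    · exact fun a ha b hb => h.span_mul_mem ha hb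
    · exact fun a ha => h.span_star_mem ha

/-- Weak continuity on vectors of a generating set implies weak continuity on the closed linear
span. -/
theorem continuous_inner_of_dense (h : IsContractiveRep ρ) {X : Set K}
    (hX : ∀ x ∈ X, ∀ y ∈ X, Continuous fun s => inner ℂ y (ρ s x)) {x y : K}
    (hx : x ∈ (Submodule.span ℂ X).topologicalClosure)
    (hy : y ∈ (Submodule.span ℂ X).topologicalClosure) :
    Continuous fun s => inner ℂ y (ρ s x) := by
  have key₁ : ∀ y : K, (∀ x ∈ X, Continuous fun s => inner ℂ y (ρ s x)) →
      ∀ x ∈ (Submodule.span ℂ X).topologicalClosure, Continuous fun s => inner ℂ y (ρ s x) := by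
    intro y hy x hx
    have hspan : ∀ x ∈ Submodule.span ℂ X, Continuous fun s => inner ℂ y (ρ s x) := by
      intro x hx
      induction hx using Submodule.span_induction with
      | mem x hx => exact hy x hx
      | zero => simp [continuous_const]
      | add a b _ _ ha hb =>
        exact (ha.add hb).congr fun s => by simp
      | smul c a _ ha => simpa [inner_smul_right] using ha.const_mul c
    rw [← SetLike.mem_coe, Submodule.topologicalClosure_coe, Metric.mem_closure_iff] at hx
    refine continuous_of_uniform_approx_of_continuous fun U hU => ?_
    obtain ⟨ε, hε, hU⟩ := Metric.mem_uniformity_dist.1 hU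
    obtain ⟨z, hz, hd⟩ := hx (ε / (‖y‖ + 1)) (by positivity)
    refine ⟨_, hspan z hz, fun s => hU ?_⟩
    rw [dist_eq_norm, ← inner_sub_right, ← map_sub]
    calc _ ≤ ‖y‖ * ‖ρ s (x - z)‖ := norm_inner_le_norm _ _
      _ ≤ ‖y‖ * ‖x - z‖ := by gcongr; exact h.norm_apply_le s _
      _ ≤ (‖y‖ + 1) * ‖x - z‖ := by gcongr; linarith
      _ < (‖y‖ + 1) * (ε / (‖y‖ + 1)) := by rw [dist_eq_norm] at hd; gcongr
      _ = ε := by field_simp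
  have key₂ : ∀ x : K, (∀ y ∈ X, Continuous fun s => inner ℂ y (ρ s x)) →
      ∀ y ∈ (Submodule.span ℂ X).topologicalClosure, Continuous fun s => inner ℂ y (ρ s x) := by
    intro x hx y hy
    have hspan : ∀ y ∈ Submodule.span ℂ X, Continuous fun s => inner ℂ y (ρ s x) := by
      intro y hy
      induction hy using Submodule.span_induction with
      | mem y hy => exact hx y hy
      | zero => simp [continuous_const]
      | add a b _ _ ha hb =>
        exact (ha.add hb).congr fun s => by simp
      | smul c a _ ha =>
        exact (ha.const_mul (starRingEnd ℂ c)).congr fun s => by simp [mul_comm]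
    rw [← SetLike.mem_coe, Submodule.topologicalClosure_coe, Metric.mem_closure_iff] at hy
    refine continuous_of_uniform_approx_of_continuous fun U hU => ?_
    obtain ⟨ε, hε, hU⟩ := Metric.mem_uniformity_dist.1 hU
    obtain ⟨z, hz, hd⟩ := hy (ε / (‖x‖ + 1)) (by positivity)
    refine ⟨_, hspan z hz, fun s => hU ?_⟩
    rw [dist_eq_norm, ← inner_sub_left]
    calc _ ≤ ‖y - z‖ * ‖ρ s x‖ := norm_inner_le_norm _ _
      _ ≤ ‖y - z‖ * ‖x‖ := by gcongr; exact h.norm_apply_le s _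
      _ ≤ ‖y - z‖ * (‖x‖ + 1) := by gcongr; linarith
      _ < (ε / (‖x‖ + 1)) * (‖x‖ + 1) := by rw [dist_eq_norm] at hd; gcongr
      _ = ε := by field_simp
  exact key₂ x (fun z hz => key₁ z (fun w hw => hX w hw z hz) x hx) y hy

variable [ContinuousMul S]

/-- Every vector of a contractive *-representation with a continuous diagonal coefficient is the
image of a vector of the universal representation under a contraction that intertwines the two
representations along the orbit. -/
theorem exists_universal_vector (h : IsContractiveRep ρ) (a : K)
    (hc : Continuous fun s => inner ℂ a (ρ s a)) :
    ∃ (T : UniversalSpace S →L[ℂ] K) (ζ : UniversalSpace S),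
      ‖T‖ ≤ 1 ∧ ‖ζ‖ ≤ ‖a‖ ∧ ∀ s, T (universalHom s ζ) = ρ s a := by
  classical
  set X : Set K := Set.range fun s => ρ s a with hXdef
  set E := (Submodule.span ℂ X).topologicalClosure with hE
  have hXc : ∀ x ∈ X, ∀ y ∈ X, Continuous fun s => inner ℂ y (ρ s x) := by
    rintro _ ⟨t, rfl⟩ _ ⟨r, rfl⟩
    have : Continuous fun s => inner ℂ a (ρ (star r * (s * t)) a) := by
      exact hc.comp (continuous_const.mul (continuous_id.mul continuous_const))
    refine this.congr fun s => ?_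
    rw [h.map_mul, h.map_mul, mul_apply_eq_comp, mul_apply_eq_comp,
      ← h.inner_star_apply (star r), star_star]
  have hEinv : ∀ s, ∀ x ∈ E, ρ s x ∈ E := by
    intro s x hx
    have hmaps : Set.MapsTo (ρ s) (Submodule.span ℂ X : Set K) (Submodule.span ℂ X : Set K) := by
      have : Submodule.span ℂ X ≤ (Submodule.span ℂ X).comap (ρ s : K →ₗ[ℂ] K) := by
        rw [Submodule.span_le]
        rintro _ ⟨t, rfl⟩
        refine Submodule.subset_span ⟨s * t, ?_⟩
        simp only [h.map_mul]; rfl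
      exact this
    exact hmaps.closure (ρ s).continuous hx
  have : CompleteSpace E := (Submodule.isClosed_topologicalClosure _).completeSpace_coe
  have : Small.{u} X := small_range _
  have hsm : Small.{u} (Submodule.span ℂ X) := Submodule.small_span X
  have : Small.{u} E := small_closure_of_small (Submodule.span ℂ X : Set K)
  obtain ⟨ι, ⟨e⟩⟩ := exists_linearIsometryEquiv_lp.{u} E
  let J : lp (fun _ : ι => ℂ) 2 →ₗᵢ[ℂ] K := E.subtypeₗᵢ.comp e.symm.toLinearIsometry
  have hJE : ∀ x, J x ∈ E := fun x => (e.symm x).2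
  have hEJ : ∀ x ∈ E, ∃ y, J y = x := fun x hx => ⟨e ⟨x, hx⟩, by simp [J]⟩
  obtain ⟨π, hπ, hJπ⟩ := h.compress J fun s x => by
    obtain ⟨y, hy⟩ := hEJ _ (hEinv s _ (hJE x))
    exact ⟨y, hy.symm⟩
  have hπc : ∀ x y, Continuous fun s => inner ℂ y (π s x) := by
    intro x y
    refine (h.continuous_inner_of_dense hXc (hJE x) (hJE y)).congr fun s => ?_
    rw [← hJπ, J.inner_map_map]
  let P : Omega S := hπ.toStarRep hπc
  have haE : a ∈ E := Submodule.le_topologicalClosure _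
    (Submodule.subset_span ⟨1, by simp [h.map_one]⟩)
  obtain ⟨b, hb⟩ := hEJ a haE
  refine ⟨J.toContinuousLinearMap ∘L lp.evalCLM ℂ (fun π : Omega S => π.H) 2 P,
    lp.single 2 P (show P.H from b), ?_, ?_, fun s => ?_⟩
  · refine ContinuousLinearMap.opNorm_le_bound _ zero_le_one fun x => ?_
    rw [one_mul]
    change ‖J (x P)‖ ≤ _
    exact (J.norm_map _).trans_le (lp.norm_apply_le_norm (by norm_num) x P)
  · rw [lp.norm_single (by norm_num), ← hb, J.norm_map]
    exact le_rfl
  · change J (P.ω s ((lp.single 2 P (show P.H from b) : UniversalSpace S) P)) = _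
    rw [lp.single_apply_self]
    change J (π s b) = _
    rw [hJπ, hb]

end IsContractiveRep

end Rep

end TopStarSemigroup
end

noncomputable section

namespace TopStarSemigroup

section TensorRep

open scoped TensorProduct
open UniformSpace

variable {S : Type u}
  {G : Type*} [NormedAddCommGroup G] [InnerProductSpace ℂ G]
  {K : Type*} [NormedAddCommGroup K] [InnerProductSpace ℂ K]

/-- The tensor product of two representations, on the completed tensor product. -/
def tensorRep (ρ : S → G →L[ℂ] G) (π : S → K →L[ℂ] K) (s : S) :
    Completion (G ⊗[ℂ] K) →L[ℂ] Completion (G ⊗[ℂ] K) :=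
  (TensorProduct.mapL (ρ s) (π s)).completion

theorem tensorRep_tmul (ρ : S → G →L[ℂ] G) (π : S → K →L[ℂ] K) (s : S) (x : G) (y : K) :
    tensorRep ρ π s ((x ⊗ₜ[ℂ] y : G ⊗[ℂ] K) : Completion (G ⊗[ℂ] K)) =
      ((ρ s x ⊗ₜ[ℂ] π s y : G ⊗[ℂ] K) : Completion (G ⊗[ℂ] K)) := by
  rw [tensorRep, ContinuousLinearMap.completion_apply_coe, TensorProduct.mapL_tmul]

variable [Monoid S] [StarMul S] [CompleteSpace G] [CompleteSpace K]

theorem IsContractiveRep.tensorRep {ρ : S → G →L[ℂ] G} {π : S → K →L[ℂ] K}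
    (hρ : IsContractiveRep ρ) (hπ : IsContractiveRep π) :
    IsContractiveRep (tensorRep ρ π) where
  map_one := by
    ext x
    induction x using Completion.induction_on with
    | hp => exact isClosed_eq (ContinuousLinearMap.continuous _) (ContinuousLinearMap.continuous _)
    | ih x =>
      simp [TopStarSemigroup.tensorRep, hρ.map_one, hπ.map_one]
  map_mul s t := by
    ext x
    induction x using Completion.induction_on with
    | hp => exact isClosed_eq (ContinuousLinearMap.continuous _) (ContinuousLinearMap.continuous _)
    | ih x =>
      rw [mul_apply_eq_comp]
      simp only [TopStarSemigroup.tensorRep, hρ.map_mul, hπ.map_mul, TensorProduct.mapL_mul,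
        ContinuousLinearMap.completion_apply_coe, mul_apply_eq_comp]
  map_star s := by
    rw [ContinuousLinearMap.star_eq_adjoint, ContinuousLinearMap.eq_adjoint_iff]
    intro x y
    induction x, y using Completion.induction_on₂ with
    | hp => apply isClosed_eq <;> fun_prop
    | ih x y =>
      simp only [TopStarSemigroup.tensorRep, ContinuousLinearMap.completion_apply_coe,
        Completion.inner_coe]
      induction x using TensorProduct.induction_on with
      | zero => simp
      | add x x' h h' => simp only [map_add, inner_add_left, h, h']
      | tmul a b =>
        induction y using TensorProduct.induction_on with
        | zero => simp
        | add x x' h h' => simp only [map_add, inner_add_right, h, h']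
        | tmul c d =>
          rw [TensorProduct.mapL_tmul, TensorProduct.mapL_tmul, TensorProduct.inner_tmul,
            TensorProduct.inner_tmul, hρ.inner_star_apply, hπ.inner_star_apply]
  norm_le_one s := by
    refine ContinuousLinearMap.opNorm_le_bound _ zero_le_one fun x => ?_
    induction x using Completion.induction_on with
    | hp => apply isClosed_le <;> fun_prop
    | ih x =>
      rw [TopStarSemigroup.tensorRep, ContinuousLinearMap.completion_apply_coe,
        Completion.norm_coe, Completion.norm_coe]
      refine (TensorProduct.mapL (ρ s) (π s)).le_of_opNorm_le ?_ x
      exact (TensorProduct.norm_mapL_le _ _).trans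
        (mul_le_one₀ (hρ.norm_le_one s) (norm_nonneg _) (hπ.norm_le_one s))

end TensorRep

section GNS

open scoped ComplexOrder

/-- The Gelfand–Naimark–Segal representation of a unital C*-algebra with respect to a state. -/
theorem exists_gns {A : Type v} [CStarAlgebra A] (φ : A →ₗ[ℂ] ℂ)
    (hφ : ∀ x, 0 ≤ φ (star x * x)) (h1 : φ 1 = 1) :
    ∃ (G : Type v) (_ : NormedAddCommGroup G) (_ : InnerProductSpace ℂ G) (_ : CompleteSpace G)
      (ρ : A →⋆ₐ[ℂ] (G →L[ℂ] G)) (Ω : G), ‖Ω‖ = 1 ∧ ∀ x, inner ℂ Ω (ρ x Ω) = φ x := by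
  let _ : PartialOrder A := CStarAlgebra.spectralOrder A
  have _ : StarOrderedRing A := CStarAlgebra.spectralOrderedRing A
  let f : A →ₚ[ℂ] ℂ := PositiveLinearMap.mk₀ φ fun x hx => by
    obtain ⟨y, rfl⟩ := CStarAlgebra.nonneg_iff_eq_star_mul_self.1 hx
    exact hφ y
  refine ⟨f.GNS, inferInstance, inferInstance, inferInstance, f.gnsStarAlgHom,
    ((f.toPreGNS 1 : f.PreGNS) : f.GNS), ?_, fun x => ?_⟩
  · rw [UniformSpace.Completion.norm_coe, f.preGNS_norm_def]
    have : f 1 = 1 := h1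
    simp [this]
  · change inner ℂ _ (f.gnsNonUnitalStarAlgHom x _) = _
    rw [f.gnsNonUnitalStarAlgHom_apply_coe, UniformSpace.Completion.inner_coe, f.preGNS_inner_def]
    have hx : φ (star 1 * (x * 1)) = φ x := by rw [star_one, one_mul, mul_one]
    exact hx

theorem isClosed_vonNeumannAlgebra {H : Type v} [NormedAddCommGroup H] [InnerProductSpace ℂ H]
    [CompleteSpace H] (M : VonNeumannAlgebra H) :
    IsClosed (M.toStarSubalgebra : Set (H →L[ℂ] H)) := by
  have := M.centralizer_centralizer'
  rw [show (M.toStarSubalgebra : Set (H →L[ℂ] H)) = M.carrier from rfl, ← this]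
  exact Set.isClosed_centralizer _

variable {S : Type u} [Monoid S] [StarMul S] [TopologicalSpace S]

/-- The positive definite function of a normal state is a coefficient of a contractive
*-representation, at a unit vector. -/
theorem IsNormalState.exists_rep (π : StarRep.{u, v} S)
    {φ : StrongDual ℂ π.M.toStarSubalgebra} (hφ : IsNormalState π.M φ) :
    ∃ (G : Type v) (_ : NormedAddCommGroup G) (_ : InnerProductSpace ℂ G) (_ : CompleteSpace G)
      (ρ : S → G →L[ℂ] G) (Ω : G), IsContractiveRep ρ ∧ ‖Ω‖ = 1 ∧
        ∀ s, inner ℂ Ω (ρ s Ω) = π.hat φ s := by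
  have : IsClosed (π.M.toStarSubalgebra : Set (π.H →L[ℂ] π.H)) := isClosed_vonNeumannAlgebra π.M
  let _ : CStarAlgebra π.M.toStarSubalgebra := StarSubalgebra.cstarAlgebra _
  obtain ⟨G, i₁, i₂, i₃, ρ, Ω, hΩ, h⟩ := exists_gns (A := π.M.toStarSubalgebra) φ.toLinearMap
    (fun x => Complex.nonneg_iff.2 ⟨(hφ.nonneg x).1, (hφ.nonneg x).2.symm⟩) hφ.map_one
  refine ⟨G, i₁, i₂, i₃, fun s => ρ ⟨π.ω s, π.mem s⟩, Ω, ⟨?_, fun s t => ?_, fun s => ?_,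
    fun s => ?_⟩, hΩ, fun s => h _⟩
  · rw [← _root_.map_one ρ]
    exact congrArg ρ (Subtype.ext π.map_one)
  · rw [← _root_.map_mul]
    exact congrArg ρ (Subtype.ext (π.map_mul s t))
  · rw [← StarHomClass.map_star]
    exact congrArg ρ (Subtype.ext (π.map_star s))
  · exact (NonUnitalStarAlgHom.norm_apply_le ρ _).trans (π.norm_le_one s)

end GNS

end TopStarSemigroup
end

noncomputable section

namespace TopStarSemigroup

/-! ### Linear maps determined by their values on the image of `S` -/

section Eval

variable {H : Type v} [NormedAddCommGroup H] [InnerProductSpace ℂ H]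

/-- The map `T ↦ R (T ζ)` on `B(H)`. -/
def evalComp (R : H →L[ℂ] H) (ζ : H) : (H →L[ℂ] H) →ₗ[ℂ] H :=
  R.toLinearMap ∘ₗ (ContinuousLinearMap.apply ℂ H ζ).toLinearMap

theorem evalComp_apply (R : H →L[ℂ] H) (ζ : H) (T : H →L[ℂ] H) : evalComp R ζ T = R (T ζ) := rfl

/-- The linear span of the maps `T ↦ R (T ζ)`. -/
def evalSpan (H : Type v) [NormedAddCommGroup H] [InnerProductSpace ℂ H] :
    Submodule ℂ ((H →L[ℂ] H) →ₗ[ℂ] H) :=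
  Submodule.span ℂ (Set.range fun p : (H →L[ℂ] H) × H => evalComp p.1 p.2)

theorem evalComp_mem (R : H →L[ℂ] H) (ζ : H) : evalComp R ζ ∈ evalSpan H :=
  Submodule.subset_span ⟨(R, ζ), rfl⟩

variable [CompleteSpace H]

theorem continuous_inner_of_mem_evalSpan {Φ : (H →L[ℂ] H) →ₗ[ℂ] H} (hΦ : Φ ∈ evalSpan H) (c : H) :
    Continuous[sigmaWeak H, inferInstance] fun T => inner ℂ c (Φ T) := by
  induction hΦ using Submodule.span_induction with
  | mem Φ h =>
    obtain ⟨⟨R, ζ⟩, rfl⟩ := h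
    convert continuous_normalFunctional (lp.single 2 0 ζ)
      (lp.single 2 0 (ContinuousLinearMap.adjoint R c)) using 1
    ext T
    rw [normalFunctional_single, ContinuousLinearMap.adjoint_inner_left, evalComp_apply]
  | zero =>
    simp only [LinearMap.zero_apply, inner_zero_right]
    exact @continuous_const _ _ (sigmaWeak H) _ _
  | add Φ Ψ _ _ h₁ h₂ =>
    simp only [LinearMap.add_apply, inner_add_right]
    exact @Continuous.add _ _ _ _ _ (sigmaWeak H) _ _ h₁ h₂
  | smul r Φ _ h =>
    simp only [LinearMap.smul_apply, inner_smul_right]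
    exact @Continuous.mul _ _ _ _ _ (sigmaWeak H) _ _ (@continuous_const _ _ (sigmaWeak H) _ _) h

end Eval

section RepExt

variable {S : Type u} [Mul S] [Star S] [TopologicalSpace S] (π : StarRep.{u, v} S)

/-- A σ-weakly continuous linear functional vanishing on the image of `S` vanishes on the generated
W*-algebra. -/
theorem StarRep.functional_eq_zero {F : (π.H →L[ℂ] π.H) →ₗ[ℂ] ℂ}
    (hF : Continuous[sigmaWeak π.H, inferInstance] F) (h : ∀ s, F (π.ω s) = 0)
    {x : π.H →L[ℂ] π.H} (hx : x ∈ π.M) : F x = 0 := by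
  rw [← SetLike.mem_coe, ← π.dense] at hx
  have : Submodule.span ℂ (Set.range π.ω) ≤ LinearMap.ker F := by
    rw [Submodule.span_le]
    rintro _ ⟨s, rfl⟩
    exact h s
  exact @Set.EqOn.closure _ _ _ (sigmaWeak π.H) _ _ F (fun _ => 0) (fun T hT => this hT) hF
    (@continuous_const _ _ (sigmaWeak π.H) _ _) x hx

theorem StarRep.apply_eq_zero_of_mem_evalSpan {Φ : (π.H →L[ℂ] π.H) →ₗ[ℂ] π.H}
    (hΦ : Φ ∈ evalSpan π.H) (h : ∀ s, Φ (π.ω s) = 0) {x : π.H →L[ℂ] π.H} (hx : x ∈ π.M) :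
    Φ x = 0 := by
  refine ext_inner_left ℂ fun c => ?_
  rw [inner_zero_right]
  exact π.functional_eq_zero (F := (innerₛₗ ℂ c) ∘ₗ Φ) (continuous_inner_of_mem_evalSpan hΦ c)
    (fun s => by simp [h]) hx

theorem StarRep.evalComp_eq {R R' : π.H →L[ℂ] π.H} {ζ ζ' : π.H}
    (h : ∀ s, R (π.ω s ζ) = R' (π.ω s ζ')) {x : π.H →L[ℂ] π.H} (hx : x ∈ π.M) :
    R (x ζ) = R' (x ζ') := by
  have := π.apply_eq_zero_of_mem_evalSpan
    (sub_mem (evalComp_mem R ζ) (evalComp_mem R' ζ')) (fun s => by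
      rw [LinearMap.sub_apply, evalComp_apply, evalComp_apply, h, sub_self]) hx
  rwa [LinearMap.sub_apply, evalComp_apply, evalComp_apply, sub_eq_zero] at this

/-- A scalar function `f` on `S` multiplies the representation `π` if every orbit of
`s ↦ f s • ω s` is a contractive image of an orbit of `ω`. -/
def StarRep.IsMultiplier (f : S → ℂ) : Prop :=
  ∀ a : π.H, ∃ (R : π.H →L[ℂ] π.H) (ζ : π.H), ‖R‖ ≤ 1 ∧ ‖ζ‖ ≤ ‖a‖ ∧
    ∀ s, R (π.ω s ζ) = f s • π.ω s a

variable {π}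

namespace StarRep.IsMultiplier

variable {f g : S → ℂ} (hf : π.IsMultiplier f) (hg : π.IsMultiplier g)

/-- The contraction in the definition of a multiplier. -/
def contraction (a : π.H) : π.H →L[ℂ] π.H := (hf a).choose

/-- The vector in the definition of a multiplier. -/
def vector (a : π.H) : π.H := (hf a).choose_spec.choose

theorem norm_contraction_le (a : π.H) : ‖hf.contraction a‖ ≤ 1 :=
  (hf a).choose_spec.choose_spec.1

theorem norm_vector_le (a : π.H) : ‖hf.vector a‖ ≤ ‖a‖ :=
  (hf a).choose_spec.choose_spec.2.1

theorem contraction_apply (a : π.H) (s : S) :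
    hf.contraction a (π.ω s (hf.vector a)) = f s • π.ω s a :=
  (hf a).choose_spec.choose_spec.2.2 s

theorem norm_contraction_apply_le (x : π.H →L[ℂ] π.H) (a : π.H) :
    ‖hf.contraction a (x (hf.vector a))‖ ≤ ‖x‖ * ‖a‖ :=
  calc _ ≤ ‖x (hf.vector a)‖ := by
        simpa using (hf.contraction a).le_of_opNorm_le (hf.norm_contraction_le a) _
    _ ≤ ‖x‖ * ‖hf.vector a‖ := x.le_opNorm _
    _ ≤ ‖x‖ * ‖a‖ := by gcongr; exact hf.norm_vector_le a

/-- The operator `x · f`. -/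
def operator (x : π.M.toStarSubalgebra) : π.H →L[ℂ] π.H :=
  LinearMap.mkContinuous
    { toFun := fun a => hf.contraction a ((x : π.H →L[ℂ] π.H) (hf.vector a))
      map_add' := fun a b => by
        have := π.apply_eq_zero_of_mem_evalSpan
          (sub_mem (evalComp_mem (hf.contraction (a + b)) (hf.vector (a + b)))
            (add_mem (evalComp_mem (hf.contraction a) (hf.vector a))
              (evalComp_mem (hf.contraction b) (hf.vector b)))) (fun s => by
            simp only [LinearMap.sub_apply, LinearMap.add_apply, evalComp_apply,
              hf.contraction_apply, map_add, smul_add, sub_self]) x.2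
        simpa only [LinearMap.sub_apply, LinearMap.add_apply, evalComp_apply, sub_eq_zero]
          using this
      map_smul' := fun c a => by
        have := π.apply_eq_zero_of_mem_evalSpan
          (sub_mem (evalComp_mem (hf.contraction (c • a)) (hf.vector (c • a)))
            (Submodule.smul_mem _ c (evalComp_mem (hf.contraction a) (hf.vector a))))
          (fun s => by
            simp only [LinearMap.sub_apply, LinearMap.smul_apply, evalComp_apply,
              hf.contraction_apply, map_smul, smul_comm c, sub_self]) x.2
        simpa only [LinearMap.sub_apply, LinearMap.smul_apply, evalComp_apply, sub_eq_zero,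
          RingHom.id_apply] using this }
    ‖(x : π.H →L[ℂ] π.H)‖ (hf.norm_contraction_apply_le _)

theorem operator_apply (x : π.M.toStarSubalgebra) (a : π.H) :
    hf.operator x a = hf.contraction a ((x : π.H →L[ℂ] π.H) (hf.vector a)) := rfl

theorem norm_operator_le (x : π.M.toStarSubalgebra) : ‖hf.operator x‖ ≤ ‖(x : π.H →L[ℂ] π.H)‖ :=
  LinearMap.mkContinuous_norm_le _ (norm_nonneg _) (hf.norm_contraction_apply_le _)

theorem operator_mem (x : π.M.toStarSubalgebra) : hf.operator x ∈ π.M := by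
  rw [← VonNeumannAlgebra.commutant_commutant π.M, VonNeumannAlgebra.mem_commutant_iff]
  intro c hc
  have hc' := VonNeumannAlgebra.mem_commutant_iff.1 hc
  ext a
  rw [mul_apply_eq_comp, mul_apply_eq_comp, operator_apply, operator_apply]
  refine π.evalComp_eq (R := c * hf.contraction a) (R' := hf.contraction (c a)) (fun s => ?_) x.2
  have := congrArg (fun T : π.H →L[ℂ] π.H => T a) (hc' _ (π.mem s))
  rw [mul_apply_eq_comp, contraction_apply, contraction_apply, map_smul]
  exact congrArg _ this.symm

/-- The map `x ↦ x · f` of the W*-algebra to itself. -/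
def action : π.M.toStarSubalgebra →L[ℂ] π.M.toStarSubalgebra :=
  LinearMap.mkContinuous
    { toFun := fun x => ⟨hf.operator x, hf.operator_mem x⟩
      map_add' := fun x y => by
        ext a
        simp [operator_apply]
      map_smul' := fun c x => by
        ext a
        simp [operator_apply] } 1 (fun x => by
      rw [one_mul]
      exact hf.norm_operator_le x)

theorem norm_action_le : ‖hf.action‖ ≤ 1 := LinearMap.mkContinuous_norm_le _ zero_le_one _

theorem action_apply (x : π.M.toStarSubalgebra) (a : π.H) :
    (hf.action x : π.H →L[ℂ] π.H) a =
      hf.contraction a ((x : π.H →L[ℂ] π.H) (hf.vector a)) := rfl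

theorem action_rep (s : S) :
    (hf.action ⟨π.ω s, π.mem s⟩) = f s • (⟨π.ω s, π.mem s⟩ : π.M.toStarSubalgebra) := by
  ext a
  rw [action_apply, contraction_apply]
  rfl

theorem action_comm (x : π.M.toStarSubalgebra) :
    hf.action (hg.action x) = hg.action (hf.action x) := by
  ext a
  rw [action_apply, action_apply, action_apply, action_apply]
  refine π.evalComp_eq
    (R := hf.contraction a * hg.contraction (hf.vector a))
    (R' := hg.contraction a * hf.contraction (hg.vector a)) (fun s => ?_) x.2
  rw [mul_apply_eq_comp, mul_apply_eq_comp, contraction_apply, contraction_apply, map_smul,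
    map_smul, contraction_apply, contraction_apply, smul_comm]

theorem comp_action_mem_predual {ψ : StrongDual ℂ π.M.toStarSubalgebra} (hψ : ψ ∈ predual π.M) :
    ψ ∘L hf.action ∈ predual π.M := by
  obtain ⟨ξ, η, h⟩ := hψ
  have h₁ : Memℓp (fun n => hf.vector (ξ n)) 2 := by
    refine memℓp_gen (((lp.memℓp ξ).summable (by norm_num)).of_nonneg_of_le
      (fun n => by positivity) fun n => ?_)
    gcongr
    exact hf.norm_vector_le _
  have h₂ : Memℓp (fun n => ContinuousLinearMap.adjoint (hf.contraction (ξ n)) (η n)) 2 := by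
    refine memℓp_gen (((lp.memℓp η).summable (by norm_num)).of_nonneg_of_le
      (fun n => by positivity) fun n => ?_)
    gcongr
    refine (ContinuousLinearMap.le_of_opNorm_le _ ?_ _).trans_eq (one_mul _)
    rw [LinearIsometryEquiv.norm_map]
    exact hf.norm_contraction_le _
  refine ⟨⟨_, h₁⟩, ⟨_, h₂⟩, fun x => ?_⟩
  rw [ContinuousLinearMap.comp_apply, h]
  refine tsum_congr fun n => ?_
  rw [action_apply]
  exact (ContinuousLinearMap.adjoint_inner_left _ _ _).symm

theorem hat_comp_action (ψ : StrongDual ℂ π.M.toStarSubalgebra) :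
    π.hat (ψ ∘L hf.action) = f * π.hat ψ := by
  ext s
  simp only [StarRep.hat, ContinuousLinearMap.comp_apply, action_rep, map_smul, smul_eq_mul,
    Pi.mul_apply]

end StarRep.IsMultiplier

end RepExt

end TopStarSemigroup
end

noncomputable section

/-! ### Invariant functionals for commuting contractions -/

section InvariantMean

variable {E : Type*} [NormedAddCommGroup E] [NormedSpace ℂ E]

/-- The average of the first `n` powers of a contraction. -/
theorem exists_average (T : E →L[ℂ] E) (hT : ‖T‖ ≤ 1) {e : E} (he : T e = e) {n : ℕ} (hn : 0 < n) :
    ∃ A : E →L[ℂ] E, ‖A‖ ≤ 1 ∧ A e = e ∧ (∀ U : E →L[ℂ] E, Commute U T → Commute U A) ∧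
      ∀ x, ‖A (x - T x)‖ ≤ 2 * ‖x‖ / n := by
  have hn' : (0 : ℝ) < n := by exact_mod_cast hn
  have hpow : ∀ k, ‖T ^ k‖ ≤ 1 := by
    intro k
    induction k with
    | zero => exact ContinuousLinearMap.norm_id_le
    | succ k ih =>
      rw [pow_succ]
      exact (norm_mul_le _ _).trans (mul_le_one₀ ih (norm_nonneg _) hT)
  have hfix : ∀ k, (T ^ k) e = e := by
    intro k
    induction k with
    | zero => rfl
    | succ k ih => rw [pow_succ, mul_apply_eq_comp, he, ih]
  have hnorm : ‖((n : ℂ)⁻¹)‖ = (n : ℝ)⁻¹ := by simp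
  refine ⟨(n : ℂ)⁻¹ • ∑ k ∈ Finset.range n, T ^ k, ?_, ?_, fun U hU => ?_, fun x => ?_⟩
  · rw [norm_smul, hnorm, inv_mul_le_iff₀ hn', mul_one]
    refine (norm_sum_le _ _).trans ((Finset.sum_le_sum fun k _ => hpow k).trans_eq ?_)
    simp
  · rw [smul_apply, sum_apply]
    simp only [hfix, Finset.sum_const, Finset.card_range]
    rw [← Nat.cast_smul_eq_nsmul ℂ, smul_smul, inv_mul_cancel₀ (by exact_mod_cast hn.ne'), one_smul]
  · exact (Commute.sum_right _ _ _ fun k _ => hU.pow_right k).smul_right _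
  · have htel : (∑ k ∈ Finset.range n, T ^ k) (x - T x) = x - (T ^ n) x := by
      have := geom_sum_mul_neg T n
      have := congrArg (fun U : E →L[ℂ] E => U x) this
      simpa using this
    rw [smul_apply, htel, norm_smul, hnorm, div_eq_inv_mul]
    gcongr
    calc _ ≤ ‖x‖ + ‖(T ^ n) x‖ := norm_sub_le _ _
      _ ≤ ‖x‖ + 1 * ‖x‖ := by gcongr; exact (T ^ n).le_of_opNorm_le (hpow n) x
      _ = 2 * ‖x‖ := by ring

/-- If `z` is a combination of differences `x - T x`, for commuting contractions `T` that fix `e`,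
then contractions fixing `e` and commuting with everything that commutes with the given maps can
make `z` arbitrarily small. -/
theorem exists_average_norm_lt {𝒯 : Set (E →L[ℂ] E)} (hnorm : ∀ T ∈ 𝒯, ‖T‖ ≤ 1)
    (hcomm : ∀ T ∈ 𝒯, ∀ U ∈ 𝒯, Commute T U) {e : E} (hfix : ∀ T ∈ 𝒯, T e = e) {z : E}
    (hz : z ∈ Submodule.span ℂ {y | ∃ T ∈ 𝒯, ∃ x, y = x - T x}) {ε : ℝ} (hε : 0 < ε) :
    ∃ A : E →L[ℂ] E, ‖A‖ ≤ 1 ∧ A e = e ∧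
      (∀ U : E →L[ℂ] E, (∀ T ∈ 𝒯, Commute U T) → Commute U A) ∧ ‖A z‖ < ε := by
  induction hz using Submodule.span_induction generalizing ε with
  | mem y hy =>
    obtain ⟨T, hT, x, rfl⟩ := hy
    obtain ⟨n, hn⟩ := exists_nat_gt (2 * ‖x‖ / ε)
    have hn0 : 0 < n := by
      have : (0 : ℝ) < n := lt_of_le_of_lt (by positivity) hn
      exact_mod_cast this
    obtain ⟨A, h₁, h₂, h₃, h₄⟩ := exists_average T (hnorm T hT) (hfix T hT) hn0
    refine ⟨A, h₁, h₂, fun U hU => h₃ U (hU T hT), (h₄ x).trans_lt ?_⟩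
    rw [div_lt_iff₀ hε] at hn
    rw [div_lt_iff₀ (by exact_mod_cast hn0)]
    linarith
  | zero =>
    exact ⟨1, ContinuousLinearMap.norm_id_le, rfl, fun U _ => Commute.one_right U, by simpa⟩
  | add y y' _ _ ih ih' =>
    obtain ⟨A, h₁, h₂, h₃, h₄⟩ := ih (half_pos hε)
    obtain ⟨B, k₁, k₂, k₃, k₄⟩ := ih' (half_pos hε)
    have hAB : Commute A B := k₃ A fun T hT => (h₃ T fun U hU => hcomm T hT U hU).symm
    refine ⟨A * B, (norm_mul_le _ _).trans (mul_le_one₀ h₁ (norm_nonneg _) k₁), ?_,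
      fun U hU => (h₃ U hU).mul_right (k₃ U hU), ?_⟩
    · rw [mul_apply_eq_comp, k₂, h₂]
    · rw [map_add]
      refine (norm_add_le _ _).trans_lt ?_
      have e₁ : ‖(A * B) y‖ ≤ ‖A y‖ := by
        rw [hAB.eq, mul_apply_eq_comp]
        simpa using B.le_of_opNorm_le k₁ (A y)
      have e₂ : ‖(A * B) y'‖ ≤ ‖B y'‖ := by
        rw [mul_apply_eq_comp]
        simpa using A.le_of_opNorm_le h₁ (B y')
      linarith
  | smul c y _ ih =>
    obtain ⟨A, h₁, h₂, h₃, h₄⟩ := ih (ε := ε / (‖c‖ + 1)) (by positivity)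
    refine ⟨A, h₁, h₂, h₃, ?_⟩
    rw [map_smul, norm_smul]
    calc _ ≤ (‖c‖ + 1) * ‖A y‖ := by gcongr; linarith
      _ < (‖c‖ + 1) * (ε / (‖c‖ + 1)) := by gcongr
      _ = ε := by field_simp

/-- A commuting family of contractions fixing a unit vector `e` has an invariant functional of norm
`1` taking the value `1` at `e`. -/
theorem exists_invariant_mean (𝒯 : Set (E →L[ℂ] E)) (hnorm : ∀ T ∈ 𝒯, ‖T‖ ≤ 1)
    (hcomm : ∀ T ∈ 𝒯, ∀ U ∈ 𝒯, Commute T U) {e : E} (he : ‖e‖ = 1) (hfix : ∀ T ∈ 𝒯, T e = e) :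
    ∃ m : StrongDual ℂ E, ‖m‖ = 1 ∧ m e = 1 ∧ ∀ T ∈ 𝒯, ∀ x, m (T x) = m x := by
  set N := Submodule.span ℂ {y | ∃ T ∈ 𝒯, ∃ x, y = x - T x} with hN
  have hdist : ∀ z ∈ N, 1 ≤ ‖e + z‖ := by
    intro z hz
    refine le_of_forall_pos_lt_add fun ε hε => ?_
    obtain ⟨A, h₁, h₂, -, h₄⟩ := exists_average_norm_lt hnorm hcomm hfix hz hε
    have : A e = A (e + z) - A z := by rw [map_add, add_sub_cancel_right]
    calc (1 : ℝ) = ‖A e‖ := by rw [h₂, he]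
      _ ≤ ‖A (e + z)‖ + ‖A z‖ := by rw [this]; exact norm_sub_le _ _
      _ < ‖e + z‖ + ε := by
        refine add_lt_add_of_le_of_lt ?_ h₄
        simpa using A.le_of_opNorm_le h₁ (e + z)
  have hq : ‖(Submodule.Quotient.mk e : E ⧸ N)‖ = 1 := by
    refine le_antisymm ((Submodule.Quotient.norm_mk_le N e).trans_eq he) ?_
    refine (QuotientAddGroup.le_norm_iff (S := N.toAddSubgroup)).2 fun w hw => ?_
    have : w - e ∈ N := (Submodule.Quotient.eq N).1 hw
    simpa using hdist _ this
  obtain ⟨g, hg, hge⟩ := exists_dual_vector ℂ (Submodule.Quotient.mk e : E ⧸ N) (by rw [hq]; simp)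
  have hmk : ∀ x, ‖g (Submodule.Quotient.mk x)‖ ≤ 1 * ‖x‖ := fun x =>
    (g.le_of_opNorm_le hg.le _).trans (by
      rw [one_mul, one_mul]; exact Submodule.Quotient.norm_mk_le N x)
  let m : StrongDual ℂ E := LinearMap.mkContinuous (g.toLinearMap ∘ₗ N.mkQ) 1 hmk
  have hme : m e = 1 := by
    change g (Submodule.Quotient.mk e) = 1
    rw [hge, hq]; simp
  refine ⟨m, le_antisymm (LinearMap.mkContinuous_norm_le _ zero_le_one _) ?_, hme,
    fun T hT x => ?_⟩
  · have := m.le_opNorm e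
    rwa [hme, he, mul_one, norm_one] at this
  · have : (Submodule.Quotient.mk (T x) : E ⧸ N) = Submodule.Quotient.mk x :=
      ((Submodule.Quotient.eq N).2 (Submodule.subset_span ⟨T, hT, x, rfl⟩)).symm
    change g (Submodule.Quotient.mk (T x)) = g (Submodule.Quotient.mk x)
    rw [this]

end InvariantMean

end

noncomputable section

namespace TopStarSemigroup

/-! ### Normal states are multipliers of the universal representation -/

section Predual

variable {H : Type v} [NormedAddCommGroup H] [InnerProductSpace ℂ H] [CompleteSpace H]

/-- The functional `T ↦ ∑ₙ ⟨T ξₙ, ηₙ⟩` as an element of the dual of `M`. -/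
def normalDual (M : VonNeumannAlgebra H) (ξ η : lp (fun _ : ℕ => H) 2) :
    StrongDual ℂ M.toStarSubalgebra :=
  LinearMap.mkContinuous
    ((innerₛₗ ℂ η) ∘ₗ amplAt ξ ∘ₗ M.toStarSubalgebra.toSubalgebra.toSubmodule.subtype)
    (‖η‖ * ‖ξ‖) fun x => by
      change ‖inner ℂ η (ampl ℕ (x : H →L[ℂ] H) ξ)‖ ≤ _
      calc _ ≤ ‖η‖ * ‖ampl ℕ (x : H →L[ℂ] H) ξ‖ := norm_inner_le_norm _ _
        _ ≤ ‖η‖ * (‖(x : H →L[ℂ] H)‖ * ‖ξ‖) := by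
          gcongr
          exact ContinuousLinearMap.le_of_opNorm_le _ (lp.norm_mapCLM_le 2 _ (norm_nonneg _) _) _
        _ = ‖η‖ * ‖ξ‖ * ‖x‖ := by rw [mul_assoc, mul_comm ‖ξ‖]; rfl

theorem normalDual_apply (M : VonNeumannAlgebra H) (ξ η : lp (fun _ : ℕ => H) 2)
    (x : M.toStarSubalgebra) : normalDual M ξ η x = normalFunctional ξ η (x : H →L[ℂ] H) :=
  (normalFunctional_eq ξ η _).symm

theorem normalDual_mem (M : VonNeumannAlgebra H) (ξ η : lp (fun _ : ℕ => H) 2) :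
    normalDual M ξ η ∈ predual M := ⟨ξ, η, normalDual_apply M ξ η⟩

theorem StarRep.continuous_hat {S : Type u} [Mul S] [Star S] [TopologicalSpace S]
    (π : StarRep.{u, v} S) {ψ : StrongDual ℂ π.M.toStarSubalgebra} (hψ : ψ ∈ predual π.M) :
    Continuous (π.hat ψ) := by
  obtain ⟨ξ, η, h⟩ := hψ
  exact (@Continuous.comp _ _ _ _ (sigmaWeak π.H) _ _ _
    (continuous_normalFunctional ξ η) π.continuous).congr fun s => (h ⟨π.ω s, π.mem s⟩).symm

end Predual

section Universal

variable {S : Type u} [Monoid S] [StarMul S] [TopologicalSpace S]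

theorem isContractiveRep_universalHom : IsContractiveRep (universalHom (S := S)) :=
  ⟨universalHom_one, universalHom_mul, universalHom_star, universalHom_norm_le⟩

/-- Every element of `F(S)` comes from a normal functional on `W*_Ω(S)`. -/
theorem exists_predual_hat_eq {g : S → ℂ} (hg : g ∈ fourierStieltjes S) :
    ∃ ψ ∈ predual (universalRep S).M, (universalRep S).hat ψ = g := by
  classical
  obtain ⟨π, ψ, ⟨ξ, η, h⟩, rfl⟩ := hg
  have hmem : ∀ ξ : lp (fun _ : ℕ => π.H) 2,
      Memℓp (fun n => (lp.single 2 π (ξ n) : UniversalSpace S)) 2 := by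
    intro ξ
    refine memℓp_gen (((lp.memℓp ξ).summable (by norm_num)).congr fun n => ?_)
    rw [lp.norm_single (by norm_num)]
  refine ⟨normalDual (universalRep S).M ⟨_, hmem ξ⟩ ⟨_, hmem η⟩, normalDual_mem _ _ _, ?_⟩
  ext s
  refine (normalDual_apply _ _ _ _).trans (Eq.trans ?_ (h _).symm)
  refine tsum_congr fun n => ?_
  change inner ℂ (lp.single 2 π (η n) : UniversalSpace S)
    (universalHom s (lp.single 2 π (ξ n) : UniversalSpace S)) = _
  rw [lp.inner_single_left, universalHom_apply, lp.single_apply_self]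

variable [ContinuousMul S]

theorem nontrivial_universalSpace : Nontrivial (UniversalSpace S) := by
  have h : IsContractiveRep (fun _ : S => (1 : ℂ →L[ℂ] ℂ)) :=
    ⟨rfl, fun _ _ => (one_mul _).symm, fun _ => (star_one _).symm,
      fun _ => ContinuousLinearMap.norm_id_le⟩
  obtain ⟨T, ζ, -, -, hT⟩ := h.exists_universal_vector 1 continuous_const
  refine ⟨ζ, 0, ?_⟩
  rintro rfl
  simpa using hT 1

theorem norm_one_wStarOmega : ‖(1 : WStarOmega S)‖ = 1 := by
  have := nontrivial_universalSpace (S := S)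
  have h : ‖(1 : UniversalSpace S →L[ℂ] UniversalSpace S)‖ = 1 := norm_one
  exact h

/-- The function `φ̂` of a normal state `φ` is a multiplier of the universal representation. -/
theorem IsNormalState.isMultiplier {φ : StrongDual ℂ (WStarOmega S)}
    (hφ : IsNormalState (universalRep S).M φ) :
    (universalRep S).IsMultiplier ((universalRep S).hat φ) := by
  intro a
  change UniversalSpace S at a
  change ∃ (R : UniversalSpace S →L[ℂ] UniversalSpace S) (ζ : UniversalSpace S), ‖R‖ ≤ 1 ∧
    ‖ζ‖ ≤ ‖a‖ ∧ ∀ s, R (universalHom s ζ) = (universalRep S).hat φ s • universalHom s a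
  obtain ⟨G, _, _, _, ρ, Ω, hρ, hΩ, hcoef⟩ := hφ.exists_rep
  let V : UniversalSpace S →L[ℂ]
      UniformSpace.Completion (TensorProduct ℂ G (UniversalSpace S)) :=
    UniformSpace.Completion.toComplL ∘L TensorProduct.mkL ℂ G (UniversalSpace S) Ω
  have hV : ∀ b, V b = ((TensorProduct.tmul ℂ Ω b : TensorProduct ℂ G (UniversalSpace S)) :
    UniformSpace.Completion (TensorProduct ℂ G (UniversalSpace S))) := fun _ => rfl
  have hVnorm : ∀ b, ‖V b‖ = ‖b‖ := fun b => by
    rw [hV, UniformSpace.Completion.norm_coe, TensorProduct.norm_tmul, hΩ, one_mul]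
  have hVrep : ∀ s b c, inner ℂ (V b) (tensorRep ρ universalHom s (V c)) =
      (universalRep S).hat φ s * inner ℂ b (universalHom s c) := fun s b c => by
    rw [hV, hV, tensorRep_tmul, UniformSpace.Completion.inner_coe, TensorProduct.inner_tmul, hcoef]
  obtain ⟨T, ζ, hT, hζ, h⟩ :=
    (hρ.tensorRep isContractiveRep_universalHom).exists_universal_vector (V a) (by
      simp only [hVrep]
      exact ((universalRep S).continuous_hat hφ.normal).mul
        ((universalRep S).continuous_inner a a))
  refine ⟨ContinuousLinearMap.adjoint V ∘L T, ζ, ?_, hζ.trans_eq (hVnorm a), fun s => ?_⟩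
  · refine (ContinuousLinearMap.opNorm_comp_le _ _).trans
      (mul_le_one₀ ?_ (norm_nonneg _) hT)
    rw [LinearIsometryEquiv.norm_map]
    exact V.opNorm_le_bound zero_le_one fun b => by rw [hVnorm, one_mul]
  · refine ext_inner_left ℂ fun b => ?_
    rw [ContinuousLinearMap.comp_apply, h, ContinuousLinearMap.adjoint_inner_right, hVrep,
      inner_smul_right]

theorem IsNormalState.isAction {φ : StrongDual ℂ (WStarOmega S)}
    (hφ : IsNormalState (universalRep S).M φ) (x : WStarOmega S) :
    IsAction x ((universalRep S).hat φ) (hφ.isMultiplier.action x) := by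
  intro g hg
  obtain ⟨ψ, hψ, rfl⟩ := exists_predual_hat_eq hg
  exact ⟨ψ (hφ.isMultiplier.action x), ⟨ψ, hψ, rfl, rfl⟩, ψ ∘L hφ.isMultiplier.action,
    hφ.isMultiplier.comp_action_mem_predual hψ, hφ.isMultiplier.hat_comp_action ψ, rfl⟩

theorem IsNormalState.action_one {φ : StrongDual ℂ (WStarOmega S)}
    (hφ : IsNormalState (universalRep S).M φ) : hφ.isMultiplier.action 1 = 1 := by
  have h : (⟨(universalRep S).ω 1, (universalRep S).mem 1⟩ : WStarOmega S) = 1 :=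
    Subtype.ext (universalRep S).map_one
  have := hφ.isMultiplier.action_rep 1
  rwa [StarRep.hat, h, hφ.map_one, one_smul] at this

end Universal

end TopStarSemigroup

end

theorem corollary3p4 (S : Type u) [Monoid S] [StarMul S] [TopologicalSpace S]
    [ContinuousMul S] [ContinuousStar S] :
    ∃ m : StrongDual ℂ (TopStarSemigroup.WStarOmega S),
      TopStarSemigroup.IsTopologicalLeftInvariantMean m := by
  obtain ⟨m, hm, hm1, hinv⟩ := exists_invariant_mean
    {T : TopStarSemigroup.WStarOmega S →L[ℂ] TopStarSemigroup.WStarOmega S |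
      ∃ φ, ∃ hφ : TopStarSemigroup.IsNormalState (TopStarSemigroup.universalRep S).M φ,
        T = hφ.isMultiplier.action}
    (by rintro _ ⟨φ, hφ, rfl⟩; exact hφ.isMultiplier.norm_action_le)
    (by
      rintro _ ⟨φ, hφ, rfl⟩ _ ⟨ψ, hψ, rfl⟩
      exact ContinuousLinearMap.ext fun x => hφ.isMultiplier.action_comm hψ.isMultiplier x)
    (e := 1) TopStarSemigroup.norm_one_wStarOmega
    (by rintro _ ⟨φ, hφ, rfl⟩; exact hφ.action_one)
  exact ⟨m, hm, hm1, fun φ hφ x =>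
    ⟨hφ.isMultiplier.action x, hφ.isAction x, hinv _ ⟨φ, hφ, rfl⟩ x⟩⟩
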